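/- There is a randomized algorithm for maximizing a non-negative, possibly non-monotone, submodular function under a knapsack constraint, and an absolute constant $C$, such that the following holds. Let $\mathcal N$ be a ground set of $n\ge 2$ elements with costs $c(x)>0$, where $c(S)=\sum_{x\in S}c(x)$, let $B>0$ be a budget, and let $\varepsilon\in(0,1/3)$. The algorithm receives $(\mathcal N,c,B,\varepsilon)$ and has access to the function $f:2^{\mathcal N}\to\mathbb R_{\ge 0}$ only through value queries (a query $S\subseteq\mathcal N$ returns $f(S)$). The queries are made in adaptive rounds: the queries of one round are made simultaneously and depend only on the random draws made so far and on the answers of earlier rounds. For every non-negative submodular $f$, i.e. $f(T\cup\{x\})-f(T)\le f(S\cup\{x\})-f(S)$ whenever $S\subseteq T\subseteq\mathcal N$ and $x\in\mathcal N\setminus T$: 1. the output $S$ always satisfies $c(S)\le B$, and the algorithm is a $(9.465+\varepsilon)$-approximation in expectation: $\max\{f(T): T\subseteq\mathcal N,\ c(T)\le B\}\le(9.465+\varepsilon)\,\mathbb E[f(S)]$; 2. for every outcome of the random draws, it uses at most $C\cdot\frac1\varepsilon\log^2 n$ adaptive rounds; 3. for every outcome of the random draws, it makes at most $C\cdot\frac{n}{\varepsilon^3}\log^3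 n\,\log\frac1\varepsilon$ value queries in total. -/

import Mathlib

universe u

/-- A set function `f` on the finite subsets of `V` is submodular if marginal values decrease:
`f (x | T) ≤ f (x | S)` whenever `S ⊆ T` and `x ∉ T`, where `f (x | S) = f (S ∪ {x}) - f S`. -/
def IsSubmodular {V : Type*} [DecidableEq V] (f : Finset V → ℝ) : Prop :=
  ∀ S T : Finset V, S ⊆ T → ∀ x : V, x ∉ T →
    f (insert x T) - f T ≤ f (insert x S) - f S

/-- A randomized adaptive algorithm that has access to a set function on `V` only through value
queries and that returns a subset of `V`.

* `ret S` halts with the output `S`;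
* `draw m μ next` draws a random `i : Fin m` with law `μ`, independently of everything drawn
  before, and goes on with `next i`;
* `round Q next` is one adaptive round: all the sets in `Q` are queried simultaneously, and
  the algorithm goes on with `next ans`, where `ans` lists the values of the sets in `Q`.

So the queries of a round can depend on the coins and on the answers of past rounds only. -/
inductive OracleAlg (V : Type*) where
  | ret (S : Finset V) : OracleAlg V
  | draw (m : ℕ) (μ : PMF (Fin m)) (next : Fin m → OracleAlg V) : OracleAlg V
  | round (Q : Finset (Finset V)) (next : (Q → ℝ) → OracleAlg V) : OracleAlg V

namespace OracleAlg

/-- The law of the output of the algorithm when its queries are answered by `f`. -/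
noncomputable def output {V : Type*} (f : Finset V → ℝ) : OracleAlg V → PMF (Finset V)
  | ret S => PMF.pure S
  | draw _ μ next => μ.bind fun i => output f (next i)
  | round _ next => output f (next fun S => f S)

/-- The number of adaptive rounds on the oracle `f`, in the worst case over the random draws. -/
def rounds {V : Type*} (f : Finset V → ℝ) : OracleAlg V → ℕ
  | ret _ => 0
  | draw _ _ next => Finset.univ.sup fun i => rounds f (next i)
  | round _ next => 1 + rounds f (next fun S => f S)

/-- The total number of value queries on the oracle `f`, in the worst case over the random
draws. -/
def queries {V : Type*} (f : Finset V → ℝ) : OracleAlg V → ℕ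
  | ret _ => 0
  | draw _ _ next => Finset.univ.sup fun i => queries f (next i)
  | round Q next => Q.card + queries f (next fun S => f S)

/-- The expected value of `f` at the output of the algorithm run on the oracle `f`. -/
noncomputable def expectedValue {V : Type*} [Fintype V] (f : Finset V → ℝ) (A : OracleAlg V) : ℝ :=
  ∑ S : Finset V, (A.output f S).toReal * f S

end OracleAlg

/-! Random-order sampling with decreasing density thresholds. Each considered element enters
`chosen` by a fair coin, whatever its marginal sign, and `kept` omits those of negative marginal. So
the prefixes of `chosen` depend on the coins alone: a sweep needs one round to find the dense
elements and one for all its prefixes (`consume_congr`). Density is tested only at geometrically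
spaced positions, hence O(log n) tests. In every outcome a sweep exceeds cost B/2 or shrinks the
dense weight by 63/64, so O(log n) sweeps serve each of O(log n) thresholds.

For the value, let O be a set of elements of cost at most B/2, and let `potential` combine three
terms. Under one coin, 2 f(kept) - f(chosen ∪ considered part of O) and f(chosen ∪ O) + `lowest` do
not decrease on average (`potential_take`). The third, f(kept) minus about τ times the chosen
weight, may drop between tests, but earlier surplus pays for this (`le_ev_drawList`). The initial
potential is at least f(O)/2. At the end, `potential_le` bounds it by 21/5 f(kept) plus a τB term,
cancelled by a chosen cost above B/2 or negligible for the last τ. An optimum has at most one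
element costlier than B/2, covered by the best singleton. The ratio is 189/20 = 9.45, so a fixed
accuracy 1/64 suffices. -/

namespace OracleAlg

/-! ### Expectation, resource bounds and random orderings for oracle programs. -/

section Semantics

variable {V : Type*}

/-- The expectation of `f` at the output, computed by recursion on the algorithm. -/
noncomputable def ev (f : Finset V → ℝ) : OracleAlg V → ℝ
  | ret S => f S
  | draw _ μ next => ∑ i, (μ i).toReal * ev f (next i)
  | round _ next => ev f (next fun S => f S)

/-- Allows the analysis to run by induction on the program instead of through output laws. -/
theorem expectedValue_eq_ev [Fintype V] [DecidableEq V] (f : Finset V → ℝ) (A : OracleAlg V) :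
    A.expectedValue f = A.ev f := by
  induction A with
  | ret S =>
    simp only [expectedValue, output, ev, PMF.pure_apply]
    rw [Finset.sum_eq_single S]
    · simp
    · intro T _ hT
      simp [hT]
    · simp
  | draw m μ next ih =>
    simp only [expectedValue] at ih
    simp only [expectedValue, output, ev, PMF.bind_apply, tsum_fintype, ← ih]
    have h (S : Finset V) : (∑ i, μ i * (output f (next i)) S).toReal * f S
        = ∑ i, (μ i).toReal * (((next i).output f S).toReal * f S) := by
      rw [ENNReal.toReal_sum fun i _ => ENNReal.mul_ne_top (PMF.apply_ne_top _ _)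
        (PMF.apply_ne_top _ _), Finset.sum_mul]
      simp only [ENNReal.toReal_mul, mul_assoc]
    simp only [h, Finset.mul_sum]
    exact Finset.sum_comm
  | round Q next ih => exact ih _

/-- On the oracle `f`, the algorithm uses at most `N` rounds and `M` queries, and all its
outputs satisfy `P`. -/
structure Bounded (f : Finset V → ℝ) (N M : ℕ) (P : Finset V → Prop) (A : OracleAlg V) : Prop where
  rounds_le : A.rounds f ≤ N
  queries_le : A.queries f ≤ M
  output_mem : ∀ S ∈ (A.output f).support, P S

theorem Bounded.draw {f : Finset V → ℝ} {N M : ℕ} {P : Finset V → Prop} {m : ℕ}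
    {μ : PMF (Fin m)} {next : Fin m → OracleAlg V} (h : ∀ i, Bounded f N M P (next i)) :
    Bounded f N M P (draw m μ next) where
  rounds_le := Finset.sup_le fun i _ => (h i).rounds_le
  queries_le := Finset.sup_le fun i _ => (h i).queries_le
  output_mem S hS := by
    obtain ⟨i, _, hi⟩ := (PMF.mem_support_bind_iff _ _ _).1 hS
    exact (h i).output_mem S hi

theorem Bounded.mono {f : Finset V → ℝ} {N N' M M' : ℕ} {P : Finset V → Prop} {A : OracleAlg V}
    (h : Bounded f N M P A) (hN : N ≤ N') (hM : M ≤ M') : Bounded f N' M' P A :=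
  ⟨h.rounds_le.trans hN, h.queries_le.trans hM, h.output_mem⟩

theorem Bounded.ret {f : Finset V → ℝ} {P : Finset V → Prop} {S : Finset V} (h : P S) :
    Bounded f 0 0 P (ret S) := by
  refine ⟨le_rfl, le_rfl, fun T hT => ?_⟩
  rw [output, PMF.mem_support_pure_iff] at hT
  exact hT ▸ h

/-- Draw a uniformly random element of `X`. -/
noncomputable def pick (X : Finset V) (hX : X.Nonempty) (k : V → OracleAlg V) : OracleAlg V :=
  haveI : Nonempty (Fin X.card) := ⟨⟨0, hX.card_pos⟩⟩
  draw X.card (PMF.uniformOfFintype _) fun i => k (X.equivFin.symm i)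

theorem ev_pick (f : Finset V → ℝ) (X : Finset V) (hX : X.Nonempty) (k : V → OracleAlg V) :
    (pick X hX k).ev f = (∑ x ∈ X, (k x).ev f) / X.card := by
  simp only [pick, ev, PMF.uniformOfFintype_apply, Fintype.card_fin, ENNReal.toReal_inv,
    ENNReal.toReal_natCast]
  rw [← Finset.mul_sum, Equiv.sum_comp X.equivFin.symm (fun x : X => (k x).ev f),
    Finset.sum_coe_sort X (fun x => (k x).ev f), div_eq_inv_mul]

/-- Toss a fair coin. -/
noncomputable def toss (k : Bool → OracleAlg V) : OracleAlg V :=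
  draw 2 (PMF.uniformOfFintype _) fun i => k (i = 0)

theorem ev_toss (f : Finset V → ℝ) (k : Bool → OracleAlg V) :
    (toss k).ev f = ((k true).ev f + (k false).ev f) / 2 := by
  simp [toss, ev, PMF.uniformOfFintype_apply, Fin.sum_univ_two]
  ring

variable [DecidableEq V]

/-- Extend the answers to the queries in `Q` by zero. -/
def extend (Q : Finset (Finset V)) (ans : Q → ℝ) (S : Finset V) : ℝ :=
  if h : S ∈ Q then ans ⟨S, h⟩ else 0

theorem extend_of_mem {Q : Finset (Finset V)} {f : Finset V → ℝ} {S : Finset V} (h : S ∈ Q) :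
    extend Q (fun S => f S) S = f S := dif_pos h

/-- One round of queries, whose answers are passed on as a set function that is zero off `Q`. -/
def ask (Q : Finset (Finset V)) (k : (Finset V → ℝ) → OracleAlg V) : OracleAlg V :=
  round Q fun ans => k (extend Q ans)

theorem ev_ask (f : Finset V → ℝ) (Q : Finset (Finset V)) (k : (Finset V → ℝ) → OracleAlg V) :
    (ask Q k).ev f = (k (extend Q fun S => f S)).ev f := rfl

theorem Bounded.ask {f : Finset V → ℝ} {N M : ℕ} {P : Finset V → Prop} {Q : Finset (Finset V)}
    {k : (Finset V → ℝ) → OracleAlg V} (h : ∀ g, Bounded f N M P (k g)) :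
    Bounded f (1 + N) (Q.card + M) P (ask Q k) where
  rounds_le := Nat.add_le_add_left (h _).rounds_le _
  queries_le := Nat.add_le_add_left (h _).queries_le _
  output_mem := (h _).output_mem

/-- Draw the first `m` entries of a uniformly random ordering of `X`, each with a fair coin. -/
noncomputable def drawList :
    ℕ → Finset V → (List (V × Bool) → OracleAlg V) → OracleAlg V
  | 0, _, k => k []
  | m + 1, X, k =>
    if hX : X.Nonempty then
      pick X hX fun x => toss fun b => drawList m (X.erase x) fun l => k ((x, b) :: l)
    else k []

theorem Bounded.drawList {f : Finset V → ℝ} {N M : ℕ} {P : Finset V → Prop} :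
    ∀ {m : ℕ} {X : Finset V} {k : List (V × Bool) → OracleAlg V},
      (∀ l : List (V × Bool), l.length ≤ m → (∀ a ∈ l, a.1 ∈ X) → Bounded f N M P (k l)) →
      Bounded f N M P (drawList m X k)
  | 0, X, k, h => h [] le_rfl (by simp)
  | m + 1, X, k, h => by
    rw [OracleAlg.drawList]
    split_ifs with hX
    · refine Bounded.draw fun i => Bounded.draw fun j => Bounded.drawList fun l hl hlX => ?_
      refine h _ (by simpa using hl) ?_
      simp only [List.mem_cons, forall_eq_or_imp]
      exact ⟨(X.equivFin.symm i).2, fun a ha => Finset.mem_of_mem_erase (hlX a ha)⟩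
    · exact h [] (Nat.zero_le _) (by simp)

theorem ev_drawList_succ (f : Finset V → ℝ) (m : ℕ) {X : Finset V} (hX : X.Nonempty)
    (k : List (V × Bool) → OracleAlg V) :
    (drawList (m + 1) X k).ev f =
      (∑ x ∈ X, ((drawList m (X.erase x) fun l => k ((x, true) :: l)).ev f +
        (drawList m (X.erase x) fun l => k ((x, false) :: l)).ev f) / 2) / X.card := by
  rw [drawList, dif_pos hX, ev_pick]
  simp only [ev_toss]

end Semantics

end OracleAlg

/-! ### The algorithm. -/

/-- The state of the algorithm: the elements chosen so far, those not yet considered, and the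
part of the chosen elements that is kept for the output. -/
structure KnapsackState (V : Type*) where
  chosen : Finset V
  avail : Finset V
  kept : Finset V

namespace KnapsackState

open OracleAlg

section Algorithm

variable {V : Type*} [DecidableEq V]

/-- Consider the element `x`: it is chosen if the coin `b` says so, and it is kept if it is chosen
and its marginal value is non-negative. -/
noncomputable def take (g : Finset V → ℝ) (s : KnapsackState V) (x : V) (b : Bool) :
    KnapsackState V where
  chosen := if b then insert x s.chosen else s.chosen
  avail := s.avail.erase x
  kept := if b = true ∧ g s.chosen ≤ g (insert x s.chosen) then insert x s.kept else s.kept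

/-- The available elements of marginal density at least `τ` with respect to the weights `w`. -/
noncomputable def dense (w : V → ℝ) (τ : ℝ) (g : Finset V → ℝ) (s : KnapsackState V) : Finset V :=
  s.avail.filter fun y => τ * w y ≤ g (insert y s.chosen) - g s.chosen

/-- Consider the elements of a list one by one until the chosen elements cost more than `B / 2` or
a test finds that the dense elements weigh less than `θ`. Here `i` elements have been considered
before, and `j` more will be considered before the next test. -/
noncomputable def consume (c w : V → ℝ) (B τ θ : ℝ) (g : Finset V → ℝ) :
    ℕ → ℕ → KnapsackState V → List (V × Bool) → KnapsackState V
  | _, _, s, [] => s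
  | i, j, s, (x, b) :: l =>
    if B / 2 < ∑ y ∈ s.chosen, c y then s
    else if j = 0 ∧ ∑ y ∈ s.dense w τ g, w y < θ then s
    else consume c w B τ θ g (i + 1) (if j = 0 then i / 32 else j - 1) (s.take g x b) l

/-- The number of tests among the next `m` elements. -/
def tests : ℕ → ℕ → ℕ → ℕ
  | _, _, 0 => 0
  | i, j, m + 1 =>
    (if j = 0 then 1 else 0) + tests (i + 1) (if j = 0 then i / 32 else j - 1) m

theorem tests_eq_zero : ∀ (m i j : ℕ), m ≤ j → tests i j m = 0
  | 0, _, _, _ => rfl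
  | m + 1, i, j, h => by
    rw [tests, if_neg (by omega), if_neg (by omega), tests_eq_zero m _ _ (by omega)]

/-- The next test is for element number i + j + 1. A test at i moves this number from i + 1 to i + 2
+ ⌊i/32⌋, which is at least 33/32 (i + 1), so the number of tests is logarithmic. -/
theorem pow_tests_mul_le : ∀ (m i j : ℕ), j < m →
    (33 / 32 : ℝ) ^ tests i j m * (i + j + 1) ≤ 33 / 32 * (i + m)
  | 0, _, _, h => by omega
  | m + 1, i, j, h => by
    rw [tests]
    by_cases hj : j = 0
    · subst hj
      simp only [if_true]
      by_cases hm : i / 32 < m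
      · have ih := pow_tests_mul_le m (i + 1) (i / 32) hm
        have h1 : (i : ℝ) ≤ 32 * ((i / 32 : ℕ) : ℝ) + 31 := by
          exact_mod_cast (by omega : i ≤ 32 * (i / 32) + 31)
        have h2 : (0 : ℝ) < (33 / 32 : ℝ) ^ tests (i + 1) (i / 32) m := by positivity
        rw [pow_add]
        push_cast at ih ⊢
        nlinarith
      · rw [tests_eq_zero m _ _ (by omega)]
        have : (0 : ℝ) ≤ m := by positivity
        push_cast
        nlinarith
    · rw [if_neg hj, if_neg hj, zero_add]
      have ih := pow_tests_mul_le m (i + 1) (j - 1) (by omega)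
      rw [Nat.cast_sub (by omega)] at ih
      push_cast at ih ⊢
      calc _ = (33 / 32 : ℝ) ^ tests (i + 1) (j - 1) m * (i + 1 + (j - 1) + 1) := by ring
        _ ≤ _ := ih
        _ = _ := by ring

theorem tests_mono : ∀ {m m' : ℕ} (i j : ℕ), m ≤ m' → tests i j m ≤ tests i j m'
  | 0, _, _, _, _ => Nat.zero_le _
  | m + 1, 0, _, _, h => by omega
  | m + 1, m' + 1, i, j, h => by
    rw [tests, tests]
    exact Nat.add_le_add_left (tests_mono _ _ (by omega)) _

/-- Return the better one of the kept elements and the set `T`. -/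
noncomputable def finish (T : Finset V) (s : KnapsackState V) : OracleAlg V :=
  ask {s.kept, T} fun g => ret (if g T ≤ g s.kept then s.kept else T)

theorem ev_finish (T : Finset V) (s : KnapsackState V) (f : Finset V → ℝ) :
    (finish T s).ev f = max (f s.kept) (f T) := by
  rw [finish, ev_ask, extend_of_mem (by simp), extend_of_mem (by simp), ev]
  split_ifs with h
  · rw [max_eq_left h]
  · rw [max_eq_right (le_of_not_ge h)]

variable [Fintype V]

/-- The queries needed to consider the elements of a list. -/
def probes : ℕ → ℕ → Finset V → List (V × Bool) → Finset (Finset V)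
  | _, _, _, [] => ∅
  | i, j, A, (x, b) :: l =>
    ({A, insert x A} ∪ if j = 0 then insert A (Finset.univ.image (insert · A)) else ∅) ∪
      probes (i + 1) (if j = 0 then i / 32 else j - 1) (if b then insert x A else A) l

theorem card_image_insert_le (A : Finset V) :
    (insert A (Finset.univ.image (insert · A))).card ≤ Fintype.card V + 1 :=
  (Finset.card_insert_le _ _).trans (Nat.add_le_add_right Finset.card_image_le _)

/-- Only a test needs all marginals; any other step needs two values. -/
theorem card_probes_le : ∀ (l : List (V × Bool)) (i j : ℕ) (A : Finset V),
    (probes i j A l).card ≤ 2 * l.length + (Fintype.card V + 1) * tests i j l.length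
  | [], _, _, _ => by simp [probes]
  | (x, b) :: l, i, j, A => by
    rw [probes, List.length_cons, tests]
    have ih := card_probes_le l (i + 1) (if j = 0 then i / 32 else j - 1)
      (if b then insert x A else A)
    have h1 : ({A, insert x A} : Finset (Finset V)).card ≤ 2 := Finset.card_le_two
    have h2 : (if j = 0 then insert A (Finset.univ.image (insert · A)) else ∅ :
        Finset (Finset V)).card ≤ (Fintype.card V + 1) * (if j = 0 then 1 else 0) := by
      split_ifs
      · simpa using card_image_insert_le A
      · simp
    refine (Finset.card_union_le _ _).trans ?_
    refine (Nat.add_le_add (Finset.card_union_le _ _) ih).trans ?_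
    rw [mul_add (Fintype.card V + 1)]
    omega

theorem dense_congr {w : V → ℝ} {τ : ℝ} {f g : Finset V → ℝ} {s : KnapsackState V}
    (h : ∀ S ∈ insert s.chosen (Finset.univ.image (insert · s.chosen)), g S = f S) :
    s.dense w τ g = s.dense w τ f := by
  refine Finset.filter_congr fun y _ => ?_
  rw [h _ (Finset.mem_insert_self _ _),
    h _ (Finset.mem_insert_of_mem (Finset.mem_image_of_mem _ (Finset.mem_univ y)))]

/-- Until the halt, `chosen` is determined by the coins and not by the answers, so `probes` can list
in advance every value that may be read. This is what makes a single round enough. -/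
theorem consume_congr {c w : V → ℝ} {B τ θ : ℝ} {f g : Finset V → ℝ} :
    ∀ (l : List (V × Bool)) (i j : ℕ) (s : KnapsackState V),
      (∀ S ∈ probes i j s.chosen l, g S = f S) →
      consume c w B τ θ g i j s l = consume c w B τ θ f i j s l
  | [], _, _, _, _ => rfl
  | (x, b) :: l, i, j, s, h => by
    simp only [probes, Finset.mem_union, or_imp, forall_and] at h
    obtain ⟨⟨h1, h2⟩, h3⟩ := h
    have ht : s.take g x b = s.take f x b := by
      rw [take, take, h1 s.chosen (by simp), h1 (insert x s.chosen) (by simp)]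
    have hd : j = 0 → s.dense w τ g = s.dense w τ f := fun hj =>
      dense_congr (by simpa only [if_pos hj] using h2)
    have hc : (j = 0 ∧ ∑ y ∈ s.dense w τ g, w y < θ) ↔
        (j = 0 ∧ ∑ y ∈ s.dense w τ f, w y < θ) :=
      and_congr_right fun hj => by rw [hd hj]
    rw [consume, consume, ht, if_congr hc rfl rfl, consume_congr l _ _ (s.take f x b) h3]

/-- Draw a random ordering of the dense elements and consider a part of it. -/
noncomputable def sweep (c w : V → ℝ) (B τ : ℝ) (s : KnapsackState V)
    (k : KnapsackState V → OracleAlg V) : OracleAlg V :=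
  ask (insert s.chosen (Finset.univ.image (insert · s.chosen))) fun g =>
    drawList (s.dense w τ g).card (s.dense w τ g) fun l =>
      ask (probes 0 0 s.chosen l) fun g' =>
        k (consume c w B τ (63 / 64 * ∑ y ∈ s.dense w τ g, w y) g' 0 0 s l)

theorem ev_sweep (c w : V → ℝ) (B τ : ℝ) (s : KnapsackState V)
    (k : KnapsackState V → OracleAlg V) (f : Finset V → ℝ) :
    (sweep c w B τ s k).ev f =
      (drawList (s.dense w τ f).card (s.dense w τ f) fun l =>
        k (consume c w B τ (63 / 64 * ∑ y ∈ s.dense w τ f, w y) f 0 0 s l)).ev f := by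
  rw [sweep, ev_ask, dense_congr fun S hS => extend_of_mem hS]
  have key : ∀ (m : ℕ) (X : Finset V) (k₁ k₂ : List (V × Bool) → OracleAlg V),
      (∀ l, (k₁ l).ev f = (k₂ l).ev f) →
      (drawList m X k₁).ev f = (drawList m X k₂).ev f := by
    intro m
    induction m with
    | zero => exact fun X k₁ k₂ h => h []
    | succ m ih =>
      intro X k₁ k₂ h
      by_cases hX : X.Nonempty
      · rw [ev_drawList_succ f m hX, ev_drawList_succ f m hX]
        congr 1
        refine Finset.sum_congr rfl fun x _ => ?_
        rw [ih _ _ (fun l => k₂ ((x, true) :: l)) fun l => h _,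
          ih _ _ (fun l => k₂ ((x, false) :: l)) fun l => h _]
      · rw [drawList, drawList, dif_neg hX, dif_neg hX, h]
  refine key _ _ _ _ fun l => ?_
  rw [ev_ask, consume_congr l 0 0 s fun S hS => extend_of_mem hS]

/-- Sweep up to `m` times with the threshold `τ`. -/
noncomputable def sweeps (c w : V → ℝ) (B τ : ℝ) (T : Finset V)
    (k : KnapsackState V → OracleAlg V) : ℕ → KnapsackState V → OracleAlg V
  | 0, s => if B / 2 < ∑ y ∈ s.chosen, c y then finish T s else k s
  | m + 1, s =>
    if B / 2 < ∑ y ∈ s.chosen, c y then finish T s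
    else sweep c w B τ s (sweeps c w B τ T k m)

/-- Go through `t` geometrically decreasing thresholds, with up to `m` sweeps for each. -/
noncomputable def phases (c w : V → ℝ) (B : ℝ) (T : Finset V) (m : ℕ) :
    ℕ → ℝ → KnapsackState V → OracleAlg V
  | 0, _, s => finish T s
  | t + 1, τ, s => sweeps c w B τ T (phases c w B T m t (63 / 64 * τ)) m s

/-- The initial state: all elements of cost at most `B / 2` are available. -/
noncomputable def init (c : V → ℝ) (B : ℝ) : KnapsackState V :=
  ⟨∅, Finset.univ.filter fun x => c x ≤ B / 2, ∅⟩

/-- Each considered set costs at most `B`, and each available element at most `B / 2`. -/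
structure Feasible (c : V → ℝ) (B : ℝ) (s : KnapsackState V) : Prop where
  kept_subset : s.kept ⊆ s.chosen
  chosen_le : ∑ x ∈ s.chosen, c x ≤ B
  avail_le : ∀ x ∈ s.avail, c x ≤ B / 2

end Algorithm

/-! ### Feasibility, rounds and queries. -/

section Resources

variable {V : Type*}

theorem feasible_init [Fintype V] (c : V → ℝ) {B : ℝ} (hB : 0 < B) : (init c B).Feasible c B where
  kept_subset := le_rfl
  chosen_le := by simpa [init] using hB.le
  avail_le x hx := (Finset.mem_filter.1 hx).2

variable [DecidableEq V]

/-- An element costing at most B/2 is added only to a set costing at most B/2. -/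
theorem Feasible.take {c : V → ℝ} {B : ℝ} {s : KnapsackState V} (hs : s.Feasible c B)
    (hB : ∑ y ∈ s.chosen, c y ≤ B / 2) {x : V} (hx : c x ≤ B / 2) (g : Finset V → ℝ) (b : Bool) :
    (s.take g x b).Feasible c B where
  kept_subset := by
    have := hs.kept_subset
    cases b
    · simpa [KnapsackState.take] using this
    · simp only [KnapsackState.take, if_true, true_and]
      split_ifs
      · exact Finset.insert_subset_insert _ this
      · exact this.trans (Finset.subset_insert _ _)
  chosen_le := by
    cases b
    · simpa [KnapsackState.take] using hs.chosen_le
    · simp only [KnapsackState.take, if_true]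
      by_cases h : x ∈ s.chosen
      · rw [Finset.insert_eq_self.2 h]
        exact hs.chosen_le
      · rw [Finset.sum_insert h]
        linarith
  avail_le y hy := hs.avail_le y (Finset.mem_of_mem_erase hy)

theorem Feasible.consume {c w : V → ℝ} {B τ θ : ℝ} {g : Finset V → ℝ} :
    ∀ {l : List (V × Bool)} {i j : ℕ} {s : KnapsackState V}, s.Feasible c B →
      (∀ a ∈ l, c a.1 ≤ B / 2) → (consume c w B τ θ g i j s l).Feasible c B
  | [], _, _, _, hs, _ => hs
  | (x, b) :: l, i, j, s, hs, hl => by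
    rw [KnapsackState.consume]
    split_ifs with h1 h2
    · exact hs
    · exact hs
    all_goals
      exact Feasible.consume (hs.take (not_lt.1 h1) (hl _ List.mem_cons_self) g b)
        fun a ha => hl a (List.mem_cons_of_mem _ ha)

theorem Feasible.finish {c : V → ℝ} {B : ℝ} {s : KnapsackState V} (hs : s.Feasible c B)
    (hc : ∀ x, 0 < c x) {T : Finset V} (hT : ∑ x ∈ T, c x ≤ B) (f : Finset V → ℝ) :
    Bounded f 1 2 (fun S => ∑ x ∈ S, c x ≤ B) (finish T s) := by
  refine (Bounded.ask fun g => Bounded.ret ?_).mono le_rfl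
    (Nat.add_le_add_right Finset.card_le_two 0)
  split_ifs
  · exact (Finset.sum_le_sum_of_subset_of_nonneg hs.kept_subset
      fun x _ _ => (hc x).le).trans hs.chosen_le
  · exact hT

variable [Fintype V]

/-- A bound on the number of queries of a sweep. -/
def sweepQueries (n : ℕ) : ℕ := (n + 1) + (2 * n + (n + 1) * tests 0 0 n)

theorem Feasible.sweep {c w : V → ℝ} {B τ : ℝ} {s : KnapsackState V} (hs : s.Feasible c B)
    {f : Finset V → ℝ} {N M : ℕ} {P : Finset V → Prop} {k : KnapsackState V → OracleAlg V}
    (hk : ∀ s', s'.Feasible c B → Bounded f N M P (k s')) :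
    Bounded f (2 + N) (sweepQueries (Fintype.card V) + M) P (sweep c w B τ s k) := by
  have hM (l : List (V × Bool)) (hl : l.length ≤ Fintype.card V) :
      (probes 0 0 s.chosen l).card ≤
        2 * Fintype.card V + (Fintype.card V + 1) * tests 0 0 (Fintype.card V) :=
    (card_probes_le l 0 0 s.chosen).trans (Nat.add_le_add (Nat.mul_le_mul_left _ hl)
      (Nat.mul_le_mul_left _ (tests_mono 0 0 hl)))
  have h := Bounded.ask (f := f) (Q := insert s.chosen (Finset.univ.image (insert · s.chosen)))
    (N := 1 + N) (P := P)
    (M := 2 * Fintype.card V + (Fintype.card V + 1) * tests 0 0 (Fintype.card V) + M)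
    (k := fun g => drawList (s.dense w τ g).card (s.dense w τ g) fun l =>
      ask (probes 0 0 s.chosen l) fun g' =>
        k (KnapsackState.consume c w B τ (63 / 64 * ∑ y ∈ s.dense w τ g, w y) g' 0 0 s l))
    fun g => Bounded.drawList fun l hl hlX => by
      refine (Bounded.ask fun g' => hk _ (hs.consume fun a ha => ?_)).mono le_rfl
        (Nat.add_le_add_right (hM l (hl.trans (Finset.card_le_univ _))) _)
      exact hs.avail_le _ (Finset.mem_filter.1 (hlX a ha)).1
  refine h.mono (by omega) ?_
  have := card_image_insert_le s.chosen
  rw [sweepQueries]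
  omega

theorem Feasible.sweeps {c w : V → ℝ} (hc : ∀ x, 0 < c x) {B τ : ℝ} {T : Finset V}
    (hT : ∑ x ∈ T, c x ≤ B) {f : Finset V → ℝ} {N M : ℕ} {k : KnapsackState V → OracleAlg V}
    (hk : ∀ s', s'.Feasible c B →
      Bounded f (1 + N) (2 + M) (fun S => ∑ x ∈ S, c x ≤ B) (k s')) :
    ∀ (m : ℕ) {s : KnapsackState V}, s.Feasible c B →
      Bounded f (1 + (m * 2 + N)) (2 + (m * sweepQueries (Fintype.card V) + M))
        (fun S => ∑ x ∈ S, c x ≤ B) (sweeps c w B τ T k m s)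
  | 0, s, hs => by
    rw [KnapsackState.sweeps]
    split_ifs
    · exact (hs.finish hc hT f).mono (by omega) (by omega)
    · exact (hk s hs).mono (by omega) (by omega)
  | m + 1, s, hs => by
    rw [KnapsackState.sweeps]
    split_ifs
    · exact (hs.finish hc hT f).mono (by omega) (by omega)
    · refine (hs.sweep fun s' hs' => Feasible.sweeps hc hT hk m hs').mono (by omega) ?_
      rw [Nat.succ_mul]
      omega

theorem Feasible.phases {c w : V → ℝ} (hc : ∀ x, 0 < c x) {B : ℝ} {T : Finset V}
    (hT : ∑ x ∈ T, c x ≤ B) {f : Finset V → ℝ} (m : ℕ) :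
    ∀ (t : ℕ) (τ : ℝ) {s : KnapsackState V}, s.Feasible c B →
      Bounded f (1 + t * (m * 2)) (2 + t * (m * sweepQueries (Fintype.card V)))
        (fun S => ∑ x ∈ S, c x ≤ B) (phases c w B T m t τ s)
  | 0, _, s, hs => by
    simpa [KnapsackState.phases] using hs.finish hc hT f
  | t + 1, τ, s, hs => by
    rw [KnapsackState.phases]
    refine (hs.sweeps hc hT (fun s' hs' => Feasible.phases hc hT m t _ hs') m).mono ?_ ?_
    · rw [Nat.succ_mul]
      omega
    · rw [Nat.succ_mul]
      omega

/-- The empty set and the feasible singletons. -/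
noncomputable def smallSets (c : V → ℝ) (B : ℝ) : Finset (Finset V) :=
  insert ∅ ((Finset.univ.filter fun x => c x ≤ B).image fun x => {x})

theorem exists_best (c : V → ℝ) (B : ℝ) (g : Finset V → ℝ) :
    ∃ T ∈ smallSets c B, ∀ S ∈ smallSets c B, g S ≤ g T :=
  (smallSets c B).exists_max_image g ⟨∅, Finset.mem_insert_self _ _⟩

/-- The best one of the empty set and the feasible singletons. -/
noncomputable def best (c : V → ℝ) (B : ℝ) (g : Finset V → ℝ) : Finset V :=
  (exists_best c B g).choose

theorem cost_le_of_mem_smallSets {c : V → ℝ} {B : ℝ} (hB : 0 < B) {T : Finset V}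
    (hT : T ∈ smallSets c B) : ∑ x ∈ T, c x ≤ B := by
  simp only [smallSets, Finset.mem_insert, Finset.mem_image, Finset.mem_filter, Finset.mem_univ,
    true_and] at hT
  obtain rfl | ⟨x, hx, rfl⟩ := hT
  · simpa using hB.le
  · simpa using hx

/-- The number of sweeps for each threshold. -/
def numSweeps (n : ℕ) : ℕ := 45 * (2 * Nat.clog 2 n + 7)

/-- The number of thresholds. -/
def numPhases (n : ℕ) : ℕ := 45 * (Nat.clog 2 n + 12)

/-- The costs, rounded up to at least `B / (64 n)`. -/
noncomputable def weight (c : V → ℝ) (B : ℝ) (x : V) : ℝ :=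
  max (c x) (B / (64 * Fintype.card V))

/-- The algorithm for submodular maximization under a knapsack constraint. -/
noncomputable def knapsackAlg (c : V → ℝ) (B : ℝ) : OracleAlg V :=
  ask (smallSets c B) fun g =>
    phases c (weight c B) B (best c B g) (numSweeps (Fintype.card V))
      (numPhases (Fintype.card V)) (64 * Fintype.card V * g (best c B g) / B) (init c B)

theorem bounded_knapsackAlg {c : V → ℝ} (hc : ∀ x, 0 < c x) {B : ℝ} (hB : 0 < B)
    (f : Finset V → ℝ) :
    Bounded f
      (2 + numPhases (Fintype.card V) * (numSweeps (Fintype.card V) * 2))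
      (Fintype.card V + 3 + numPhases (Fintype.card V) *
        (numSweeps (Fintype.card V) * sweepQueries (Fintype.card V)))
      (fun S => ∑ x ∈ S, c x ≤ B) (knapsackAlg c B) := by
  refine (Bounded.ask fun g => (feasible_init c hB).phases hc
    (cost_le_of_mem_smallSets hB (exists_best c B g).choose_spec.1) _ _ _).mono (by omega) ?_
  have : (smallSets c B).card ≤ Fintype.card V + 1 :=
    (Finset.card_insert_le _ _).trans
      (Nat.add_le_add_right (Finset.card_image_le.trans (Finset.card_le_univ _)) _)
  omega

theorem clog_le_log {n : ℕ} (hn : 2 ≤ n) : (Nat.clog 2 n : ℝ) ≤ 3 * Real.log n := by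
  have h1 : (2 : ℝ) ^ (Nat.clog 2 n - 1) ≤ n := by
    exact_mod_cast (Nat.pow_pred_clog_lt_self one_lt_two (by omega)).le
  have h2 := Real.log_le_log (by positivity) h1
  rw [Real.log_pow, Nat.cast_sub (Nat.clog_pos one_lt_two hn)] at h2
  have h3 := Real.log_two_gt_d9
  have h4 : Real.log 2 ≤ Real.log n := Real.log_le_log two_pos (by exact_mod_cast hn)
  have h5 : (0 : ℝ) ≤ Nat.clog 2 n := Nat.cast_nonneg _
  push_cast at h2
  nlinarith

theorem tests_le_log {n : ℕ} (hn : 2 ≤ n) : (tests 0 0 n : ℝ) ≤ 40 * Real.log n := by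
  have h := pow_tests_mul_le n 0 0 (by omega)
  have h1 := Real.log_le_log (by positivity) h
  have hn0 : (0 : ℝ) < n := by exact_mod_cast (by omega : 0 < n)
  norm_num at h1
  rw [Real.log_mul (by norm_num) hn0.ne'] at h1
  have h2 : 1 - (33 / 32 : ℝ)⁻¹ ≤ Real.log (33 / 32) :=
    Real.one_sub_inv_le_log_of_pos (by norm_num)
  have h3 := Real.log_two_gt_d9
  have h4 : Real.log 2 ≤ Real.log n := Real.log_le_log two_pos (by exact_mod_cast hn)
  have h5 : (0 : ℝ) ≤ tests 0 0 n := Nat.cast_nonneg _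
  norm_num at h2
  by_contra! hcon
  nlinarith [mul_le_mul_of_nonneg_right h2 (by linarith : 0 ≤ (tests 0 0 n : ℝ) - 1)]

end Resources

end KnapsackState

/-! ### Submodularity and the change of the potential under one coin. -/

theorem IsSubmodular.union_le {V : Type*} [DecidableEq V] {f : Finset V → ℝ}
    (hf : IsSubmodular f) {A S : Finset V} (hAS : A ⊆ S) (D : Finset V) :
    Disjoint S D → f (S ∪ D) ≤ f S + ∑ x ∈ D, (f (insert x A) - f A) := by
  induction D using Finset.induction_on with
  | empty => simp
  | insert x D hx ih =>
    intro hD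
    rw [Finset.disjoint_insert_right] at hD
    have h := hf A (S ∪ D) (hAS.trans Finset.subset_union_left) x (by simp [hD.1, hx])
    have := ih hD.2
    rw [Finset.sum_insert hx, Finset.union_insert]
    linarith

namespace KnapsackState

open OracleAlg

section Potential

variable {V : Type*} [DecidableEq V] {f : Finset V → ℝ} {w : V → ℝ} {τ : ℝ} {O U : Finset V}
  {s : KnapsackState V} {x : V}

/-- The least value of `f` on the union of the chosen elements, of `O`, and of some available
elements. -/
noncomputable def lowest (f : Finset V → ℝ) (O : Finset V) (s : KnapsackState V) : ℝ :=
  s.avail.powerset.inf' ⟨∅, Finset.empty_mem_powerset _⟩ fun D => f (s.chosen ∪ D ∪ O)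

theorem lowest_le {D : Finset V} (hD : D ⊆ s.avail) : s.lowest f O ≤ f (s.chosen ∪ D ∪ O) :=
  Finset.inf'_le (fun D => f (s.chosen ∪ D ∪ O)) (Finset.mem_powerset.2 hD)

theorem exists_eq_lowest (f : Finset V → ℝ) (O : Finset V) (s : KnapsackState V) :
    ∃ D ⊆ s.avail, s.lowest f O = f (s.chosen ∪ D ∪ O) := by
  obtain ⟨D, hD, h⟩ := Finset.exists_mem_eq_inf' (s := s.avail.powerset)
    ⟨∅, Finset.empty_mem_powerset _⟩ fun D => f (s.chosen ∪ D ∪ O)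
  exact ⟨D, Finset.mem_powerset.1 hD, h⟩

/-- The potential function of the analysis. -/
noncomputable def potential (w : V → ℝ) (τ : ℝ) (f : Finset V → ℝ) (O : Finset V)
    (s : KnapsackState V) : ℝ :=
  2 * f s.kept - f (s.chosen ∪ (O \ s.avail)) + (f (s.chosen ∪ O) + s.lowest f O) / 2 +
    11 / 5 * (f s.kept - 61 / 64 * τ * ∑ x ∈ s.chosen, w x)

/-- The invariant of the analysis: available elements belong to `U` and have density at most `64 / 63 * τ`. -/
structure Sparse (w : V → ℝ) (U : Finset V) (τ : ℝ) (f : Finset V → ℝ) (s : KnapsackState V) : Prop where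
  kept_subset : s.kept ⊆ s.chosen
  avail_subset : s.avail ⊆ U
  disjoint : Disjoint s.chosen s.avail
  gain_le : ∀ x ∈ s.avail, f (insert x s.chosen) - f s.chosen ≤ 64 / 63 * τ * w x

theorem Sparse.notMem (hs : s.Sparse w U τ f) (hx : x ∈ s.avail) : x ∉ s.chosen :=
  fun h => Finset.disjoint_left.1 hs.disjoint h hx

theorem Sparse.gain_take_le (hs : s.Sparse w U τ f) (hf : IsSubmodular f) (b : Bool) {y : V}
    (hy : y ∈ s.avail.erase x) :
    f (insert y (s.take f x b).chosen) - f (s.take f x b).chosen ≤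
      f (insert y s.chosen) - f s.chosen := by
  obtain ⟨hyx, hy⟩ := Finset.mem_erase.1 hy
  have hyA := hs.notMem hy
  cases b
  · simp [take]
  · simp only [take, if_true]
    exact hf _ _ (Finset.subset_insert _ _) y (by simp [hyx, hyA])

theorem Sparse.take (hs : s.Sparse w U τ f) (hf : IsSubmodular f) (x : V) (b : Bool) :
    (s.take f x b).Sparse w U τ f where
  kept_subset := by
    have := hs.kept_subset
    cases b
    · simpa [KnapsackState.take] using this
    · simp only [KnapsackState.take, if_true, true_and]
      split_ifs
      · exact Finset.insert_subset_insert _ this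
      · exact this.trans (Finset.subset_insert _ _)
  avail_subset := (Finset.erase_subset x _).trans hs.avail_subset
  disjoint := by
    have := hs.disjoint.mono_right (Finset.erase_subset x s.avail)
    cases b
    · simpa [KnapsackState.take] using this
    · simpa [KnapsackState.take] using this
  gain_le y hy := (hs.gain_take_le hf b hy).trans (hs.gain_le y (Finset.mem_of_mem_erase hy))

theorem Sparse.dense_take_subset (hs : s.Sparse w U τ f) (hf : IsSubmodular f) (x : V) (b : Bool) :
    (s.take f x b).dense w τ f ⊆ (s.dense w τ f).erase x := by
  intro y hy
  obtain ⟨hy, hg⟩ := Finset.mem_filter.1 hy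
  exact Finset.mem_erase.2 ⟨(Finset.mem_erase.1 hy).1, Finset.mem_filter.2
    ⟨Finset.mem_of_mem_erase hy, hg.trans (hs.gain_take_le hf b hy)⟩⟩

/-- Replaces the usual sampling lemma for E f(chosen ∪ O). If x is chosen, the minimum ranges over
fewer sets. If x is rejected, it may fall by at most the marginal of x at chosen ∪ O, which is
exactly what f(chosen ∪ O) gains in the other branch. -/
theorem Sparse.lowest_take (hs : s.Sparse w U τ f) (hf : IsSubmodular f) (hx : x ∈ s.avail) :
    2 * (f (s.chosen ∪ O) + s.lowest f O) ≤
      (f ((s.take f x true).chosen ∪ O) + (s.take f x true).lowest f O) +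
      (f ((s.take f x false).chosen ∪ O) + (s.take f x false).lowest f O) := by
  obtain ⟨D, hD, hDeq⟩ := exists_eq_lowest f O (s.take f x true)
  obtain ⟨E, hE, hEeq⟩ := exists_eq_lowest f O (s.take f x false)
  rw [hDeq, hEeq]
  simp only [KnapsackState.take, if_true, Bool.false_eq_true, if_false] at hD hE ⊢
  have hins {D : Finset V} (hD : D ⊆ s.avail.erase x) : insert x D ⊆ s.avail :=
    Finset.insert_subset hx (hD.trans (Finset.erase_subset _ _))
  have h1 := lowest_le (f := f) (O := O) (hins hD)
  have h2 := lowest_le (f := f) (O := O) (hins hE)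
  have h3 : s.chosen ∪ insert x D ∪ O = insert x s.chosen ∪ D ∪ O := by
    rw [Finset.union_insert, Finset.insert_union, Finset.insert_union, Finset.insert_union]
  have h4 : s.chosen ∪ insert x E ∪ O = insert x (s.chosen ∪ E ∪ O) := by
    rw [Finset.union_insert, Finset.insert_union]
  have h5 : f (insert x (s.chosen ∪ E ∪ O)) - f (s.chosen ∪ E ∪ O) ≤
      f (insert x s.chosen ∪ O) - f (s.chosen ∪ O) := by
    rw [Finset.insert_union]
    by_cases hxO : x ∈ O
    · rw [Finset.insert_eq_self.2 (Finset.mem_union_right _ hxO),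
        Finset.insert_eq_self.2 (Finset.mem_union_right _ hxO)]
      simp
    · refine hf _ _ (Finset.union_subset_union_left Finset.subset_union_left) x ?_
      have : x ∉ E := fun h => (Finset.mem_erase.1 (hE h)).1 rfl
      simp [hs.notMem hx, hxO, this]
  rw [h3] at h1
  rw [h4] at h2
  linarith

/-- An x in O joins the set in both branches, any other x in only one; each time its marginal is at
most that at `chosen`. -/
theorem Sparse.considered_take (hs : s.Sparse w U τ f) (hf : IsSubmodular f) (hx : x ∈ s.avail) :
    f ((s.take f x true).chosen ∪ (O \ (s.take f x true).avail)) +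
      f ((s.take f x false).chosen ∪ (O \ (s.take f x false).avail)) ≤
      2 * f (s.chosen ∪ (O \ s.avail)) + 2 * max 0 (f (insert x s.chosen) - f s.chosen) := by
  simp only [KnapsackState.take, if_true, Bool.false_eq_true, if_false]
  have hg : f (insert x (s.chosen ∪ (O \ s.avail))) - f (s.chosen ∪ (O \ s.avail)) ≤
      max 0 (f (insert x s.chosen) - f s.chosen) :=
    (hf _ _ Finset.subset_union_left x (by simp [hs.notMem hx, hx])).trans (le_max_right _ _)
  have h0 : 0 ≤ max 0 (f (insert x s.chosen) - f s.chosen) := le_max_left _ _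
  rw [Finset.insert_union]
  by_cases hxO : x ∈ O
  · have h : O \ s.avail.erase x = insert x (O \ s.avail) := by
      ext y
      by_cases hyx : y = x <;> simp [hyx, hxO]
    rw [h, Finset.union_insert, Finset.insert_idem]
    linarith
  · have h : O \ s.avail.erase x = O \ s.avail := by
      ext y
      by_cases hyx : y = x <;> simp [hyx, hxO]
    rw [h]
    linarith

/-- Marginals at `kept` dominate those at the larger set `chosen`. -/
theorem Sparse.kept_take (hs : s.Sparse w U τ f) (hf : IsSubmodular f) (hx : x ∈ s.avail) :
    f s.kept + max 0 (f (insert x s.chosen) - f s.chosen) ≤ f (s.take f x true).kept := by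
  simp only [KnapsackState.take, true_and]
  split_ifs with h
  · rw [max_eq_right (sub_nonneg.2 h)]
    linarith [hf _ _ hs.kept_subset x (hs.notMem hx)]
  · rw [max_eq_left (by linarith), add_zero]

/-- Twice the gain of `kept` in one branch pays for `considered_take`; only the 11/5 term leaves a
remainder. -/
theorem Sparse.potential_take (hs : s.Sparse w U τ f) (hf : IsSubmodular f) (hx : x ∈ s.avail) :
    2 * s.potential w τ f O +
        11 / 5 * (max 0 (f (insert x s.chosen) - f s.chosen) - 61 / 64 * τ * w x) ≤
      (s.take f x true).potential w τ f O + (s.take f x false).potential w τ f O := by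
  have h1 := hs.lowest_take (O := O) hf hx
  have h2 := hs.considered_take (O := O) hf hx
  have h3 := hs.kept_take hf hx
  have h4 : (s.take f x false).kept = s.kept := by simp [KnapsackState.take]
  have h5 : ∑ y ∈ (s.take f x true).chosen, w y = w x + ∑ y ∈ s.chosen, w y := by
    simp [KnapsackState.take, Finset.sum_insert (hs.notMem hx)]
  have h6 : (s.take f x false).chosen = s.chosen := by simp [KnapsackState.take]
  simp only [potential, h4, h5, h6] at h1 h2 ⊢
  linarith

end Potential

theorem ev_drawList_of_forall_eq {V : Type*} [DecidableEq V] (f : Finset V → ℝ)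
    {A : OracleAlg V} : ∀ (m : ℕ) (X : Finset V) (k : List (V × Bool) → OracleAlg V),
      (∀ l, k l = A) → (drawList m X k).ev f = A.ev f
  | 0, _, k, h => by rw [drawList, h]
  | m + 1, X, k, h => by
    by_cases hX : X.Nonempty
    · rw [ev_drawList_succ f m hX]
      have h0 : (X.card : ℝ) ≠ 0 := by exact_mod_cast hX.card_pos.ne'
      have (x : V) (b : Bool) : (drawList m (X.erase x) fun l => k ((x, b) :: l)).ev f = A.ev f :=
        ev_drawList_of_forall_eq f m _ _ fun l => h _
      simp only [this, add_self_div_two, Finset.sum_const, nsmul_eq_mul]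
      field_simp
    · rw [drawList, dif_neg hX, h]

/-! ### One sweep: surplus and debt between tests. -/

section Analysis

variable {V : Type*} [DecidableEq V] {f : Finset V → ℝ} {c w : V → ℝ} {B τ θ a e : ℝ}
  {O U : Finset V}

/-- Averaging the inequalities for the possible next elements. -/
theorem average_le {X : Finset V} {m : ℕ} (hX : X.card = m + 1) (hτ : 0 ≤ τ) (hw : ∀ x, 0 ≤ w x)
    {κ κ' Φ a e : ℝ} (hκ' : 0 ≤ κ') {p v : V → ℝ}
    (hp : τ * (κ' - κ) * ∑ x ∈ X, w x ≤ ∑ x ∈ X, (p x - 61 / 64 * τ * w x))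
    (h : ∀ x ∈ X, 2 * Φ + 11 / 5 * (p x - 61 / 64 * τ * w x) -
      11 / 5 * τ * (κ' * ((∑ y ∈ X.erase x, w y) / m)) ≤ a * v x + 2 * e) :
    Φ - 11 / 10 * τ * (κ * ((∑ x ∈ X, w x) / (m + 1 : ℕ))) ≤
      a * ((∑ x ∈ X, v x / 2) / X.card) + e := by
  set W := ∑ x ∈ X, w x with hW
  have hW0 : 0 ≤ W := Finset.sum_nonneg fun x _ => hw x
  have hm : (0 : ℝ) < (m + 1 : ℕ) := by positivity
  have hsum := Finset.sum_le_sum h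
  -- Removing a uniform element preserves the mean weight in expectation; for m = 0 the quotient is
  -- 0, hence only an inequality.
  have herase : ∑ x ∈ X, (∑ y ∈ X.erase x, w y) / m ≤ W := by
    have h1 : ∑ x ∈ X, ∑ y ∈ X.erase x, w y = m * W := by
      have : ∀ x ∈ X, ∑ y ∈ X.erase x, w y = W - w x := fun x hx => by
        rw [hW, ← Finset.add_sum_erase X w hx]
        ring
      rw [Finset.sum_congr rfl this, Finset.sum_sub_distrib, Finset.sum_const, hX, ← hW,
        nsmul_eq_mul]
      push_cast
      ring
    rw [← Finset.sum_div, h1]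
    rcases Nat.eq_zero_or_pos m with rfl | hm'
    · simpa using hW0
    · rw [mul_div_cancel_left₀]
      exact_mod_cast hm'.ne'
  simp only [Finset.sum_sub_distrib, Finset.sum_add_distrib, ← Finset.mul_sum, Finset.sum_const,
    hX, nsmul_eq_mul, ← hW] at hsum hp
  have h2 : τ * (κ' * ∑ x ∈ X, (∑ y ∈ X.erase x, w y) / m) ≤ τ * (κ' * W) :=
    mul_le_mul_of_nonneg_left (mul_le_mul_of_nonneg_left herase hκ') hτ
  rw [← Finset.sum_div, hX]
  have key : ((m + 1 : ℕ) : ℝ) * Φ - 11 / 10 * τ * κ * W ≤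
      a * ((∑ x ∈ X, v x) / 2) + (m + 1 : ℕ) * e := by
    nlinarith
  have := div_le_div_of_nonneg_right key hm.le
  calc _ = (((m + 1 : ℕ) : ℝ) * Φ - 11 / 10 * τ * κ * W) / (m + 1 : ℕ) := by field_simp
    _ ≤ _ := this
    _ = _ := by field_simp

/-- The subtracted term is an allowance, in units of τ times the mean remaining weight. While the
dense weight is at least θ, each step earns 1/32, giving i/32 in total. Once it is below θ, each of
the j steps before the next test costs at most 1. Tests are spaced so that j ≤ i/32, and the
allowance is 0 at i = j = 0. -/
theorem Sparse.le_ev_drawList (hf : IsSubmodular f) (hτ : 0 ≤ τ) (hw : ∀ x, 0 ≤ w x)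
    {k : KnapsackState V → OracleAlg V}
    (hk : ∀ s' : KnapsackState V, s'.Sparse w U τ f →
      (B / 2 < ∑ x ∈ s'.chosen, c x ∨ ∑ x ∈ s'.dense w τ f, w x ≤ θ) →
      s'.potential w τ f O ≤ a * (k s').ev f + e) :
    ∀ (m : ℕ) (X : Finset V) (i j : ℕ) (s : KnapsackState V), X.card = m → s.Sparse w U τ f →
      X ⊆ s.avail → s.dense w τ f ⊆ X → 32 * j ≤ i → 63 / 64 * ∑ x ∈ X, w x ≤ θ →
      s.potential w τ f O - 11 / 10 * τ *
          ((if θ ≤ ∑ x ∈ s.dense w τ f, w x then (i : ℝ) / 32 else j) *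
            ((∑ x ∈ X, w x) / m)) ≤
        a * (drawList m X fun l => k (consume c w B τ θ f i j s l)).ev f + e
  | 0, X, i, j, s, hX, hs, _, hd, _, hθ => by
    rw [Finset.card_eq_zero] at hX
    subst hX
    rw [Finset.subset_empty] at hd
    simpa [drawList, consume] using hk s hs (Or.inr (by simpa [hd] using hθ))
  | m + 1, X, i, j, s, hX, hs, hXU, hd, hij, hθ => by
    have hhalt (h : ∀ l, consume c w B τ θ f i j s l = s)
        (h' : B / 2 < ∑ x ∈ s.chosen, c x ∨ ∑ x ∈ s.dense w τ f, w x ≤ θ) :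
        s.potential w τ f O - 11 / 10 * τ *
          ((if θ ≤ ∑ x ∈ s.dense w τ f, w x then (i : ℝ) / 32 else j) *
            ((∑ x ∈ X, w x) / (m + 1 : ℕ))) ≤
        a * (drawList (m + 1) X fun l => k (consume c w B τ θ f i j s l)).ev f + e := by
      rw [ev_drawList_of_forall_eq f (A := k s) _ _ _ fun l => by rw [h]]
      have h1 : 0 ≤ (if θ ≤ ∑ x ∈ s.dense w τ f, w x then (i : ℝ) / 32 else j) := by
        split_ifs <;> positivity
      have h2 : 0 ≤ ∑ x ∈ X, w x := Finset.sum_nonneg fun x _ => hw x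
      have h3 : 0 ≤ 11 / 10 * τ *
          ((if θ ≤ ∑ x ∈ s.dense w τ f, w x then (i : ℝ) / 32 else j) *
            ((∑ x ∈ X, w x) / (m + 1 : ℕ))) := by positivity
      linarith [hk s hs h']
    by_cases hB : B / 2 < ∑ x ∈ s.chosen, c x
    · refine hhalt (fun l => ?_) (Or.inl hB)
      rcases l with _ | ⟨⟨x, b⟩, l⟩
      · rfl
      · rw [consume, if_pos hB]
    by_cases ht : j = 0 ∧ ∑ x ∈ s.dense w τ f, w x < θ
    · refine hhalt (fun l => ?_) (Or.inr ht.2.le)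
      rcases l with _ | ⟨⟨x, b⟩, l⟩
      · rfl
      · rw [consume, if_neg hB, if_pos ht]
    have hXne : X.Nonempty := Finset.card_pos.1 (by omega)
    rw [ev_drawList_succ f m hXne]
    simp only [consume, if_neg hB, if_neg ht]
    set j' := if j = 0 then i / 32 else j - 1 with hj'
    have hj'i : 32 * j' ≤ i + 1 := by
      rw [hj']
      split_ifs <;> omega
    have hdle (x : V) (b : Bool) :
        ∑ y ∈ (s.take f x b).dense w τ f, w y ≤ ∑ y ∈ s.dense w τ f, w y :=
      Finset.sum_le_sum_of_subset_of_nonneg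
        ((hs.dense_take_subset hf x b).trans (Finset.erase_subset _ _)) fun y _ _ => hw y
    have ih (x : V) (hx : x ∈ X) (b : Bool) :=
      Sparse.le_ev_drawList hf hτ hw hk m (X.erase x) (i + 1) j' (s.take f x b)
        (by rw [Finset.card_erase_of_mem hx, hX, Nat.add_sub_cancel]) (hs.take hf x b)
        (Finset.erase_subset_erase x hXU)
        ((hs.dense_take_subset hf x b).trans (Finset.erase_subset_erase x hd)) hj'i
        ((mul_le_mul_of_nonneg_left (Finset.sum_le_sum_of_subset_of_nonneg
          (Finset.erase_subset x X) fun y _ _ => hw y) (by norm_num)).trans hθ)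
    have haux (κ' : ℝ) (hκ' : ∀ x b,
        (if θ ≤ ∑ y ∈ (s.take f x b).dense w τ f, w y then ((i + 1 : ℕ) : ℝ) / 32 else j') ≤ κ')
        (x : V) (hx : x ∈ X) :
        2 * s.potential w τ f O +
            11 / 5 * (max 0 (f (insert x s.chosen) - f s.chosen) - 61 / 64 * τ * w x) -
            11 / 5 * τ * (κ' * ((∑ y ∈ X.erase x, w y) / m)) ≤
          a * ((drawList m (X.erase x) fun l =>
                k (consume c w B τ θ f (i + 1) j' (s.take f x true) l)).ev f +
              (drawList m (X.erase x) fun l =>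
                k (consume c w B τ θ f (i + 1) j' (s.take f x false) l)).ev f) + 2 * e := by
      have hq : 0 ≤ (∑ y ∈ X.erase x, w y) / m :=
        div_nonneg (Finset.sum_nonneg fun y _ => hw y) (Nat.cast_nonneg _)
      have h1 := hs.potential_take (O := O) hf (hXU hx)
      have h2 := ih x hx true
      have h3 := ih x hx false
      have h4 := mul_le_mul_of_nonneg_left
        (mul_le_mul_of_nonneg_right (hκ' x true) hq) hτ
      have h5 := mul_le_mul_of_nonneg_left
        (mul_le_mul_of_nonneg_right (hκ' x false) hq) hτ
      linarith
    have hW : 0 ≤ ∑ x ∈ X, w x := Finset.sum_nonneg fun x _ => hw x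
    by_cases hok : θ ≤ ∑ x ∈ s.dense w τ f, w x
    · rw [if_pos hok]
      refine average_le hX hτ hw (κ' := ((i + 1 : ℕ) : ℝ) / 32) (by positivity) ?_
        (haux _ fun x b => ?_)
      -- Dense elements carry at least 63/64 of the weight of X, and 63/64 - 61/64 = 1/32.
      · have h1 : τ * ∑ x ∈ s.dense w τ f, w x ≤
            ∑ x ∈ X, max 0 (f (insert x s.chosen) - f s.chosen) := by
          rw [Finset.mul_sum]
          refine (Finset.sum_le_sum fun x hx => ?_).trans
            (Finset.sum_le_sum_of_subset_of_nonneg hd fun x _ _ => le_max_left _ _)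
          exact (Finset.mem_filter.1 hx).2.trans (le_max_right _ _)
        have h2 := mul_le_mul_of_nonneg_left (hθ.trans hok) hτ
        rw [Finset.sum_sub_distrib, ← Finset.mul_sum]
        push_cast
        linarith
      · split_ifs
        · exact le_rfl
        · rw [le_div_iff₀ (by norm_num)]
          exact_mod_cast (by omega : j' * 32 ≤ i + 1)
    · rw [if_neg hok]
      have hj0 : j ≠ 0 := fun h => ht ⟨h, not_le.1 hok⟩
      have hj1 : (j' : ℝ) = j - 1 := by
        rw [hj', if_neg hj0, Nat.cast_sub (by omega), Nat.cast_one]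
      refine average_le hX hτ hw (κ' := j') (Nat.cast_nonneg _) ?_ (haux _ fun x b => ?_)
      -- No gain is assumed here: the loss 61/64 is paid by lowering the allowance from j to j - 1.
      · have h1 : 0 ≤ ∑ x ∈ X, max 0 (f (insert x s.chosen) - f s.chosen) :=
          Finset.sum_nonneg fun x _ => le_max_left _ _
        have h2 : 0 ≤ τ * ∑ x ∈ X, w x := mul_nonneg hτ hW
        rw [Finset.sum_sub_distrib, ← Finset.mul_sum, hj1]
        linarith
      · rw [if_neg fun h => hok (h.trans (hdle x b))]

end Analysis

/-! ### Sweeps and thresholds. -/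

section Loops

variable {V : Type*} [DecidableEq V] {f : Finset V → ℝ} {c w : V → ℝ}
  {B τ a e : ℝ} {O T U : Finset V} {s : KnapsackState V}

/-- The potential at the end of the run, in terms of the kept elements. -/
theorem Sparse.potential_le (hs : s.Sparse w U τ f) (hf : IsSubmodular f) (hτ : 0 ≤ τ)
    (hw : ∀ x, 0 ≤ w x) (hO : ∑ x ∈ O, w x ≤ 65 / 64 * B) :
    s.potential w τ f O ≤ 21 / 5 * f s.kept + 65 / 63 * τ * B -
      11 / 5 * (61 / 64) * τ * ∑ x ∈ s.chosen, w x := by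
  -- With D = ∅, the half-sum in the potential is at most f(chosen ∪ O); what remains is the
  -- marginal of the unconsidered part of O.
  have h1 := lowest_le (f := f) (O := O) (Finset.empty_subset s.avail)
  rw [Finset.union_empty] at h1
  have hU : s.chosen ∪ (O \ s.avail) ∪ (O ∩ s.avail) = s.chosen ∪ O := by
    rw [Finset.union_assoc, Finset.sdiff_union_inter]
  have hdisj : Disjoint (s.chosen ∪ (O \ s.avail)) (O ∩ s.avail) :=
    Finset.disjoint_union_left.2 ⟨hs.disjoint.mono_right Finset.inter_subset_right,
      Finset.sdiff_disjoint.mono_right Finset.inter_subset_right⟩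
  have h2 := hf.union_le (A := s.chosen) Finset.subset_union_left _ hdisj
  rw [hU] at h2
  have h3 : ∑ x ∈ O ∩ s.avail, (f (insert x s.chosen) - f s.chosen) ≤ 65 / 63 * τ * B := by
    calc _ ≤ ∑ x ∈ O ∩ s.avail, 64 / 63 * τ * w x :=
          Finset.sum_le_sum fun x hx => hs.gain_le x (Finset.mem_inter.1 hx).2
      _ ≤ ∑ x ∈ O, 64 / 63 * τ * w x :=
          Finset.sum_le_sum_of_subset_of_nonneg Finset.inter_subset_left
            fun x _ _ => mul_nonneg (by positivity) (hw x)
      _ = 64 / 63 * τ * ∑ x ∈ O, w x := by rw [Finset.mul_sum]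
      _ ≤ 64 / 63 * τ * (65 / 64 * B) := mul_le_mul_of_nonneg_left hO (by positivity)
      _ = _ := by ring
  unfold potential
  linarith

variable [Fintype V]

theorem Sparse.le_ev_sweep (hs : s.Sparse w U τ f) (hf : IsSubmodular f) (hτ : 0 ≤ τ)
    (hw : ∀ x, 0 ≤ w x) {k : KnapsackState V → OracleAlg V}
    (hk : ∀ s' : KnapsackState V, s'.Sparse w U τ f →
      (B / 2 < ∑ x ∈ s'.chosen, c x ∨
        ∑ x ∈ s'.dense w τ f, w x ≤ 63 / 64 * ∑ x ∈ s.dense w τ f, w x) →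
      s'.potential w τ f O ≤ a * (k s').ev f + e) :
    s.potential w τ f O ≤ a * (sweep c w B τ s k).ev f + e := by
  have h := Sparse.le_ev_drawList (O := O) hf hτ hw hk _ (s.dense w τ f) 0 0 s rfl hs
    (Finset.filter_subset _ _) le_rfl le_rfl le_rfl
  rw [ev_sweep]
  simpa using h

/-- Weights are at least δ, so a dense set weighing less than δ is empty. Then all densities are
below τ, the `Sparse` bound for 63/64 τ. -/
theorem Sparse.le_ev_sweeps (hf : IsSubmodular f) (hτ : 0 ≤ τ) (hw : ∀ x, 0 ≤ w x) {δ : ℝ}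
    (hδ : ∀ x, δ ≤ w x) {k : KnapsackState V → OracleAlg V}
    (hfin : ∀ s' : KnapsackState V, s'.Sparse w U τ f → B / 2 < ∑ x ∈ s'.chosen, c x →
      s'.potential w τ f O ≤ a * (finish T s').ev f + e)
    (hk : ∀ s' : KnapsackState V, s'.Sparse w U (63 / 64 * τ) f →
      s'.potential w (63 / 64 * τ) f O ≤ a * (k s').ev f + e) :
    ∀ (m : ℕ) {s : KnapsackState V}, s.Sparse w U τ f →
      (B / 2 < ∑ x ∈ s.chosen, c x ∨ (63 / 64) ^ m * ∑ x ∈ s.dense w τ f, w x < δ) →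
      s.potential w τ f O ≤ a * (sweeps c w B τ T k m s).ev f + e
  | 0, s, hs, hd => by
    rw [sweeps]
    split_ifs with hB
    · exact hfin s hs hB
    · have hd := hd.resolve_left hB
      rw [pow_zero, one_mul] at hd
      have hempty : ∀ y ∈ s.avail, f (insert y s.chosen) - f s.chosen < τ * w y := by
        intro y hy
        by_contra! hcon
        have hmem : y ∈ s.dense w τ f := Finset.mem_filter.2 ⟨hy, hcon⟩
        linarith [Finset.single_le_sum (f := w) (fun x _ => hw x) hmem, hδ y]
      refine le_trans ?_ (hk s ⟨hs.kept_subset, hs.avail_subset, hs.disjoint, fun x hx => ?_⟩)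
      -- Lowering τ only raises the potential.
      · have : 0 ≤ τ * ∑ x ∈ s.chosen, w x := mul_nonneg hτ (Finset.sum_nonneg fun x _ => hw x)
        unfold potential
        linarith
      · linarith [hempty x hx]
  | m + 1, s, hs, hd => by
    rw [sweeps]
    split_ifs with hB
    · exact hfin s hs hB
    · refine hs.le_ev_sweep hf hτ hw fun s' hs' hd' =>
        Sparse.le_ev_sweeps hf hτ hw hδ hfin hk m hs' (hd'.imp_right fun h => ?_)
      refine lt_of_le_of_lt ?_ (hd.resolve_left hB)
      calc _ ≤ (63 / 64 : ℝ) ^ m * (63 / 64 * ∑ x ∈ s.dense w τ f, w x) :=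
            mul_le_mul_of_nonneg_left h (by positivity)
        _ = _ := by ring

/-- Here 189/40 = 21/5 + 1/2 + 1/40: the kept value, the f(T)/2 reserved for a costly element, and
the residue of the last threshold. -/
theorem Sparse.le_ev_phases (hf : IsSubmodular f) (hf0 : ∀ S, 0 ≤ f S) (hB : 0 < B)
    (hcw : ∀ x, c x ≤ w x) (hw : ∀ x, 0 ≤ w x) {δ : ℝ} (hδ : ∀ x, δ ≤ w x) {m : ℕ}
    (hm : (63 / 64) ^ m * ∑ x ∈ U, w x < δ)
    (hO : ∑ x ∈ O, w x ≤ 65 / 64 * B) :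
    ∀ (t : ℕ) {τ : ℝ} {s : KnapsackState V}, 0 ≤ τ → s.Sparse w U τ f →
      65 / 63 * ((63 / 64) ^ t * τ) * B ≤ f T / 40 →
      s.potential w τ f O ≤ 189 / 40 * (phases c w B T m t τ s).ev f + -(f T / 2)
  | 0, τ, s, hτ, hs, hτt => by
    rw [phases, ev_finish]
    have h1 := hs.potential_le hf hτ hw hO
    have h2 : 0 ≤ τ * ∑ x ∈ s.chosen, w x := mul_nonneg hτ (Finset.sum_nonneg fun x _ => hw x)
    have h3 := le_max_left (f s.kept) (f T)
    have h4 := le_max_right (f s.kept) (f T)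
    rw [pow_zero, one_mul] at hτt
    linarith [hf0 T]
  | t + 1, τ, s, hτ, hs, hτt => by
    rw [phases]
    refine Sparse.le_ev_sweeps hf hτ hw hδ (fun s' hs' hB' => ?_) (fun s' hs' => ?_) m hs
      (Or.inr ?_)
    · rw [ev_finish]
      have h1 := hs'.potential_le hf hτ hw hO
      have h2 : B / 2 ≤ ∑ x ∈ s'.chosen, w x :=
        hB'.le.trans (Finset.sum_le_sum fun x _ => hcw x)
      have h3 := mul_le_mul_of_nonneg_left h2 hτ
      have h4 := le_max_left (f s'.kept) (f T)
      have h5 := le_max_right (f s'.kept) (f T)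
      -- The τB terms cancel because 11/5 · 61/64 · 1/2 > 65/63, which is why the potential has the
      -- factor 11/5.
      have h6 : 0 ≤ τ * B := mul_nonneg hτ hB.le
      linarith [hf0 T]
    · refine Sparse.le_ev_phases hf hf0 hB hcw hw hδ hm hO t (by positivity) hs' ?_
      calc _ = 65 / 63 * ((63 / 64) ^ (t + 1) * τ) * B := by ring
        _ ≤ _ := hτt
    · refine lt_of_le_of_lt (mul_le_mul_of_nonneg_left ?_ (by positivity)) hm
      exact Finset.sum_le_sum_of_subset_of_nonneg
        ((Finset.filter_subset _ _).trans hs.avail_subset) fun x _ _ => hw x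

end Loops

/-! ### The approximation ratio. -/

section Approximation

variable {V : Type*} [Fintype V] {f : Finset V → ℝ} {c : V → ℝ} {B : ℝ}

theorem pow_mul_le {n k : ℕ} : (63 / 64 : ℝ) ^ (45 * (Nat.clog 2 n + k)) * n ≤ (1 / 2) ^ k := by
  have h1 : (63 / 64 : ℝ) ^ 45 ≤ 1 / 2 := by norm_num
  have h2 : (n : ℝ) ≤ 2 ^ Nat.clog 2 n := by exact_mod_cast Nat.le_pow_clog one_lt_two n
  calc _ ≤ (1 / 2 : ℝ) ^ (Nat.clog 2 n + k) * 2 ^ Nat.clog 2 n := by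
        rw [pow_mul]
        exact mul_le_mul (pow_le_pow_left₀ (by positivity) h1 _) h2 (by positivity) (by positivity)
    _ = (1 / 2) ^ k := by
        rw [pow_add, mul_right_comm, ← mul_pow]
        norm_num

theorem pow_numSweeps_mul_lt (hn : 2 ≤ Fintype.card V) (hB : 0 < B)
    {U : Finset V} (hU : ∀ x ∈ U, c x ≤ B / 2) :
    (63 / 64) ^ numSweeps (Fintype.card V) * ∑ x ∈ U, weight c B x <
      B / (64 * Fintype.card V) := by
  set n := Fintype.card V with hndef
  have hn1 : (1 : ℝ) ≤ n := by exact_mod_cast (by omega : 1 ≤ n)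
  have h1 : ∑ x ∈ U, weight c B x ≤ n * B := by
    calc _ ≤ ∑ _x ∈ U, B := Finset.sum_le_sum fun x hx =>
          max_le (by linarith [hU x hx]) (div_le_self hB.le (by linarith))
      _ = U.card * B := by rw [Finset.sum_const, nsmul_eq_mul]
      _ ≤ n * B := by
        gcongr
        exact Finset.card_le_univ U
  have h2 := pow_mul_le (n := n) (k := 7)
  have h3 := pow_mul_le (n := n) (k := 0)
  have h4 : (63 / 64 : ℝ) ^ numSweeps n * n * n ≤ (1 / 2) ^ 7 := by
    -- The weight must fall from nB to below B/(64n): one factor n for each logarithm, and 2^7 > 64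
    -- for strictness.
    have : numSweeps n = 45 * (Nat.clog 2 n + 7) + 45 * (Nat.clog 2 n + 0) := by
      rw [numSweeps]
      ring
    calc _ = ((63 / 64 : ℝ) ^ (45 * (Nat.clog 2 n + 7)) * n) *
          ((63 / 64 : ℝ) ^ (45 * (Nat.clog 2 n + 0)) * n) := by
          rw [this, pow_add, mul_assoc, mul_mul_mul_comm]
      _ ≤ (1 / 2) ^ 7 * (1 / 2) ^ 0 := mul_le_mul h2 h3 (by positivity) (by positivity)
      _ = _ := by norm_num
  generalize numSweeps n = N at h4 ⊢
  rw [lt_div_iff₀ (by positivity)]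
  calc _ ≤ (63 / 64 : ℝ) ^ N * (n * B) * (64 * n) := by gcongr
    _ = (63 / 64 : ℝ) ^ N * n * n * (64 * B) := by ring
    _ ≤ (1 / 2) ^ 7 * (64 * B) := by gcongr
    _ < B := by
      norm_num
      linarith

variable [DecidableEq V]

/-- At most one element of T costs more than B/2; removing it loses at most the value of its
singleton. -/
theorem exists_small_subset (hf : IsSubmodular f) (hf0 : ∀ S, 0 ≤ f S) (hc : ∀ x, 0 < c x)
    {T : Finset V} (hT : ∑ x ∈ T, c x ≤ B) {S : Finset V}
    (hS : ∀ R ∈ smallSets c B, f R ≤ f S) :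
    ∃ O : Finset V, (∀ x ∈ O, c x ≤ B / 2) ∧ ∑ x ∈ O, c x ≤ B ∧ f T ≤ f O + f S := by
  by_cases h : ∀ x ∈ T, c x ≤ B / 2
  · exact ⟨T, h, hT, by linarith [hf0 S]⟩
  push Not at h
  obtain ⟨x, hx, hxB⟩ := h
  have hsum := Finset.add_sum_erase T c hx
  have hpos : ∀ y ∈ T.erase x, 0 ≤ c y := fun y _ => (hc y).le
  refine ⟨T.erase x, fun y hy => ?_, by linarith [hc x], ?_⟩
  · linarith [Finset.single_le_sum hpos hy]
  · have h1 := hf ∅ (T.erase x) (Finset.empty_subset _) x (Finset.notMem_erase x T)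
    have h2 : f {x} ≤ f S := hS _ <| Finset.mem_insert_of_mem <| Finset.mem_image.2
      ⟨x, Finset.mem_filter.2 ⟨Finset.mem_univ x, by linarith [Finset.sum_nonneg hpos]⟩, rfl⟩
    rw [Finset.insert_erase hx] at h1
    rw [insert_empty_eq] at h1
    linarith [hf0 ∅]

theorem le_ev_knapsackAlg (hn : 2 ≤ Fintype.card V) (hB : 0 < B) (hc : ∀ x, 0 < c x)
    (hf : IsSubmodular f) (hf0 : ∀ S, 0 ≤ f S) {T : Finset V} (hT : ∑ x ∈ T, c x ≤ B) :
    f T ≤ 189 / 20 * (knapsackAlg c B).ev f := by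
  set n := Fintype.card V with hndef
  have hn0 : (0 : ℝ) < n := by exact_mod_cast (by omega : 0 < n)
  rw [knapsackAlg, ev_ask]
  set g := extend (smallSets c B) fun S => f S with hg
  obtain ⟨hSmem, hSmax⟩ := (exists_best c B g).choose_spec
  have hgf : ∀ R ∈ smallSets c B, g R = f R := fun R hR => extend_of_mem hR
  have hbest : ∀ R ∈ smallSets c B, f R ≤ f (best c B g) := fun R hR => by
    rw [← hgf R hR, ← hgf (best c B g) hSmem]
    exact hSmax R hR
  rw [show g (best c B g) = f (best c B g) from hgf _ hSmem]
  set S := best c B g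
  obtain ⟨O, hO, hOB, hfT⟩ := exists_small_subset hf hf0 hc hT hbest
  have hδ : ∀ x, B / (64 * n) ≤ weight c B x := fun x => le_max_right _ _
  have hw : ∀ x, 0 ≤ weight c B x := fun x => le_trans (by positivity) (hδ x)
  -- Rounding adds at most B/(64n) per element, hence B/64 altogether.
  have hOw : ∑ x ∈ O, weight c B x ≤ 65 / 64 * B := by
    calc _ ≤ ∑ x ∈ O, (c x + B / (64 * n)) := Finset.sum_le_sum fun x _ =>
          max_le (le_add_of_nonneg_right (by positivity)) (le_add_of_nonneg_left (hc x).le)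
      _ = ∑ x ∈ O, c x + O.card * (B / (64 * n)) := by
          rw [Finset.sum_add_distrib, Finset.sum_const, nsmul_eq_mul]
      _ ≤ B + n * (B / (64 * n)) := by
          gcongr
          exact Finset.card_le_univ O
      _ = _ := by
          field_simp
          ring
  set τ := 64 * n * f S / B with hτdef
  have hS0 := hf0 S
  have hτ : 0 ≤ τ := by positivity
  have hinit : (init c B).Sparse (weight c B) (init c B).avail τ f := by
    refine ⟨le_rfl, le_rfl, Finset.disjoint_empty_left _, fun x hx => ?_⟩
    have hx : c x ≤ B / 2 := (Finset.mem_filter.1 hx).2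
    have h1 : f {x} ≤ f S := hbest _ <| Finset.mem_insert_of_mem <| Finset.mem_image.2
      ⟨x, Finset.mem_filter.2 ⟨Finset.mem_univ x, by linarith⟩, rfl⟩
    have h2 : f S ≤ τ * weight c B x := by
      calc f S = τ * (B / (64 * n)) := by
            rw [hτdef]
            field_simp
        _ ≤ _ := mul_le_mul_of_nonneg_left (hδ x) hτ
    have h3 : f (insert x (init c B).chosen) = f {x} := by
      rw [init, insert_empty_eq]
    have := hf0 (init c B).chosen
    linarith
  have hend : 65 / 63 * ((63 / 64) ^ numPhases n * τ) * B ≤ f S / 40 := by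
    have h := mul_le_mul_of_nonneg_right (pow_mul_le (n := n) (k := 12)) hS0
    calc _ = 65 / 63 * 64 * ((63 / 64 : ℝ) ^ numPhases n * n * f S) := by
          rw [hτdef]
          field_simp
      -- The 12 in `numPhases` is the least exponent making this at most f(S)/40.
      _ ≤ 65 / 63 * 64 * ((1 / 2) ^ 12 * f S) := mul_le_mul_of_nonneg_left h (by norm_num)
      _ ≤ f S / 40 := by
          norm_num
          linarith
  have hmain := Sparse.le_ev_phases (O := O) (T := S) (c := c) (w := weight c B) hf hf0 hB
    (fun x => le_max_left _ _) hw hδ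
    (pow_numSweeps_mul_lt hn hB fun x hx => (Finset.mem_filter.1 hx).2) hOw
    (numPhases n) hτ hinit hend
  -- All of O is available, so the subtracted value is f(∅), outweighed by 2 f(∅), and `lowest` is
  -- non-negative.
  have hstart : f O / 2 ≤ (init c B).potential (weight c B) τ f O := by
    have h1 : O \ (init c B).avail = ∅ := Finset.sdiff_eq_empty_iff_subset.2 fun x hx =>
      Finset.mem_filter.2 ⟨Finset.mem_univ x, hO x hx⟩
    obtain ⟨D, -, hD⟩ := exists_eq_lowest f O (init c B)
    rw [potential, h1, hD]
    have h2 := hf0 ((init c B).chosen ∪ D ∪ O)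
    have h3 := hf0 ∅
    simp only [init, Finset.empty_union, Finset.sum_empty] at h2 ⊢
    linarith
  linarith

end Approximation

/-! ### Numerical bounds on rounds and queries. -/

theorem two_thirds_le_log {n : ℕ} (hn : 2 ≤ n) : 2 / 3 ≤ Real.log n := by
  have := Real.log_le_log two_pos (by exact_mod_cast hn : (2 : ℝ) ≤ n)
  linarith [Real.log_two_gt_d9]

theorem numPhases_le {n : ℕ} (hn : 2 ≤ n) : (numPhases n : ℝ) ≤ 1000 * Real.log n := by
  have h1 := clog_le_log hn
  have h2 := two_thirds_le_log hn
  rw [numPhases]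
  push_cast
  linarith

theorem numSweeps_le {n : ℕ} (hn : 2 ≤ n) : (numSweeps n : ℝ) ≤ 1000 * Real.log n := by
  have h1 := clog_le_log hn
  have h2 := two_thirds_le_log hn
  rw [numSweeps]
  push_cast
  linarith

theorem sweepQueries_le {n : ℕ} (hn : 2 ≤ n) :
    (sweepQueries n : ℝ) ≤ 100 * (n * Real.log n) := by
  have h1 := tests_le_log hn
  have h2 := two_thirds_le_log hn
  have hn' : (2 : ℝ) ≤ n := by exact_mod_cast hn
  have h3 : ((n : ℝ) + 1) * tests 0 0 n ≤ 3 / 2 * n * (40 * Real.log n) :=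
    mul_le_mul (by linarith) h1 (Nat.cast_nonneg _) (by positivity)
  have h4 : (n : ℝ) * (2 / 3) ≤ n * Real.log n := mul_le_mul_of_nonneg_left h2 (by positivity)
  rw [sweepQueries]
  push_cast
  linarith

theorem rounds_le {n : ℕ} (hn : 2 ≤ n) {ε : ℝ} (hε : 0 < ε) (hε' : ε < 1 / 3) :
    ((2 + numPhases n * (numSweeps n * 2) : ℕ) : ℝ) ≤
      10 ^ 8 * (1 / ε * Real.log n ^ 2) := by
  have h0 := two_thirds_le_log hn
  have h1 : (numPhases n : ℝ) * numSweeps n ≤ 1000 * Real.log n * (1000 * Real.log n) :=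
    mul_le_mul (numPhases_le hn) (numSweeps_le hn) (Nat.cast_nonneg _) (by positivity)
  have h2 : (2 / 3 : ℝ) ^ 2 ≤ Real.log n ^ 2 := by gcongr
  have h3 : 1 ≤ 1 / ε := by
    rw [le_div_iff₀ hε]
    linarith
  calc _ ≤ 10 ^ 8 * (1 * Real.log n ^ 2) := by
        push_cast
        linarith
    _ ≤ _ := by gcongr

theorem queries_le {n : ℕ} (hn : 2 ≤ n) {ε : ℝ} (hε : 0 < ε) (hε' : ε < 1 / 3) :
    ((n + 3 + numPhases n * (numSweeps n * sweepQueries n) : ℕ) : ℝ) ≤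
      10 ^ 12 * (n / ε ^ 3 * Real.log n ^ 3 * Real.log (1 / ε)) := by
  have h0 := two_thirds_le_log hn
  have hn' : (2 : ℝ) ≤ n := by exact_mod_cast hn
  have h1 : (numPhases n : ℝ) * (numSweeps n * sweepQueries n) ≤
      1000 * Real.log n * (1000 * Real.log n * (100 * (n * Real.log n))) :=
    mul_le_mul (numPhases_le hn)
      (mul_le_mul (numSweeps_le hn) (sweepQueries_le hn) (Nat.cast_nonneg _) (by positivity))
      (by positivity) (by positivity)
  have h2 : n * (2 / 3 : ℝ) ^ 3 ≤ n * Real.log n ^ 3 := by gcongr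
  have h3 : (n : ℝ) ≤ n / ε ^ 3 := by
    rw [le_div_iff₀ (by positivity)]
    exact mul_le_of_le_one_right (by positivity) (pow_le_one₀ hε.le (by linarith))
  have h4 : 2 / 3 ≤ Real.log (1 / ε) := by
    have h : (2 : ℝ) ≤ 1 / ε := by
      rw [le_div_iff₀ hε]
      linarith
    linarith [Real.log_le_log two_pos h, Real.log_two_gt_d9]
  calc _ ≤ 10 ^ 12 * (n * Real.log n ^ 3 * (2 / 3)) := by
        push_cast
        linarith
    _ ≤ _ := by gcongr

end KnapsackState

theorem theorem3p6 :
    ∃ (C : ℝ) (alg : ∀ (V : Type u) [Fintype V] [DecidableEq V],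
        (V → ℝ) → ℝ → ℝ → OracleAlg V),
      ∀ (V : Type u) [Fintype V] [DecidableEq V] (c : V → ℝ) (B ε : ℝ) (f : Finset V → ℝ),
        2 ≤ Fintype.card V → (∀ x, 0 < c x) → 0 < B → 0 < ε → ε < 1 / 3 →
        (∀ S, 0 ≤ f S) → IsSubmodular f →
          (∀ S ∈ ((alg V c B ε).output f).support, ∑ x ∈ S, c x ≤ B) ∧
          (∀ T : Finset V, ∑ x ∈ T, c x ≤ B →
            f T ≤ (9.465 + ε) * (alg V c B ε).expectedValue f) ∧
          ((alg V c B ε).rounds f : ℝ) ≤ C * (1 / ε * Real.log (Fintype.card V) ^ 2) ∧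
          ((alg V c B ε).queries f : ℝ) ≤
            C * (Fintype.card V / ε ^ 3 * Real.log (Fintype.card V) ^ 3 * Real.log (1 / ε)) := by
  refine ⟨10 ^ 12, fun V _ _ c B _ => KnapsackState.knapsackAlg c B, ?_⟩
  intro V _ _ c B ε f hn hc hB hε hε' hf0 hf
  have hb := KnapsackState.bounded_knapsackAlg hc hB f
  refine ⟨hb.output_mem, fun T hT => ?_, ?_, ?_⟩
  · rw [OracleAlg.expectedValue_eq_ev]
    have h := KnapsackState.le_ev_knapsackAlg hn hB hc hf hf0 hT
    have h0 : 0 ≤ (KnapsackState.knapsackAlg c B).ev f := by linarith [hf0 T]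
    refine h.trans (mul_le_mul_of_nonneg_right ?_ h0)
    norm_num
    linarith
  · refine (Nat.cast_le.2 hb.rounds_le).trans ((KnapsackState.rounds_le hn hε hε').trans ?_)
    gcongr <;> norm_num
  · exact (Nat.cast_le.2 hb.queries_le).trans (KnapsackState.queries_le hn hε hε')
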